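/- Let $A$ be a unital locally $C^*$-algebra with respect to a family $\{P_\alpha\}_{\alpha\in\Delta}$ of $C^*$-seminorms. That is, $A$ is a unital complex $*$-algebra, each $P_\alpha$ is a seminorm with $P_\alpha(ab)\le P_\alpha(a)P_\alpha(b)$, $P_\alpha(a^*)=P_\alpha(a)$ and $P_\alpha(a^*a)=P_\alpha(a)^2$ for all $a,b\in A$, and $A$ is Hausdorff and complete in the locally convex topology defined by $\{P_\alpha\}$. An element of $A$ is called positive if it has the form $b^*b$ with $b\in A$. Let $X$ be a Hilbert $A$-module. That is, $X$ is a right $A$-module with a map $\langle\cdot,\cdot\rangle:X\times X\to A$ such that $\langle x,x\rangle\ge 0$, $\langle x,x\rangle=0$ iff $x=0$, $\langle x_1+x_2,y\rangle=\langle x_1,y\rangle+\langle x_2,y\rangle$, $\langle xa,y\rangle=\langle x,y\rangle a$ and $\langle x,y\rangle^*=\langle y,x\rangle$ for all $x,x_1,x_2,y\in X$ and $a\in A$, and $X$ is complete in the locally convex topology defined by the seminorms $\bar P_\alpha(x)=P_\alpha(\langle x,x\rangle)^{1/2}$, $\alpha\in\Delta$. Fix $\alpha\in\Delta$ and put $I_\alpha=\{a\in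 A: P_\alpha(a)=0\}$, $A_\alpha=A/I_\alpha$ with the norm $\|a+I_\alpha\|=P_\alpha(a)$, $\bar I_\alpha=\{x\in X:\langle x,x\rangle\in I_\alpha\}$, and $X_\alpha=X/\bar I_\alpha$ with the norm $\|x+\bar I_\alpha\|=\bar P_\alpha(x)$. Let $A^s=\{a\in A:\sup_{\beta\in\Delta}P_\beta(a)<\infty\}$, let $X^s=\{x\in X:\langle x,x\rangle\in A^s\}$ with the norm $\|x\|^s=\sup_{\beta\in\Delta}\bar P_\beta(x)$, and let $\bar J_\alpha=\bar I_\alpha\cap X^s$. Then: 1. $A_\alpha$ is complete, hence a $C^*$-algebra, and $X_\alpha$, with the action $(x+\bar I_\alpha)(a+I_\alpha)=xa+\bar I_\alpha$ and the inner product $\langle x+\bar I_\alpha,y+\bar I_\alpha\rangle=\langle x,y\rangle+I_\alpha$, is a Hilbert $C^*$-module over $A_\alpha$: the inner product satisfies the axioms above over $A_\alpha$, $\|\xi\|=\|\langle\xi,\xi\rangle\|^{1/2}$ for all $\xi\in X_\alpha$, and $X_\alpha$ is complete. 2. The linear map $X^s/\bar J_\alpha\to X_\alpha$, $x+\bar J_\alpha\mapsto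 x+\bar I_\alpha$, is isometric for the quotient norm $\|x+\bar J_\alpha\|=\inf_{y\in\bar J_\alpha}\|x+y\|^s$, and its image is closed and dense in $X_\alpha$. -/

import Mathlib

open MulOpposite

noncomputable section

section Completion

open UniformSpace

variable {B : Type*} [NormedRing B] [StarRing B] [CStarRing B] [NormedAlgebra ℂ B] [StarModule ℂ B]

lemma completion_map_star_coe (b : B) :
    Completion.map (star : B → B) (b : Completion B) = ((star b : B) : Completion B) :=
  Completion.map_coe (starNormedAddGroupHom (E := B)).uniformContinuous b

/-- The involution on the completion of `B`, extended by continuity. -/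
@[reducible]
def completionStarRing : StarRing (Completion B) where
  star := Completion.map star
  star_involutive x := by
    have hc : Continuous (Completion.map (star : B → B)) := Completion.continuous_map
    induction x using Completion.induction_on with
    | hp => exact isClosed_eq (hc.comp hc) continuous_id
    | ih a => simp [completion_map_star_coe]
  star_mul x y := by
    have hc : Continuous (Completion.map (star : B → B)) := Completion.continuous_map
    induction x, y using Completion.induction_on₂ with
    | hp => exact isClosed_eq (hc.comp (by fun_prop))
              ((hc.comp continuous_snd).mul (hc.comp continuous_fst))
    | ih a b => simp only [← Completion.coe_mul, completion_map_star_coe, star_mul]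
  star_add x y := by
    have hc : Continuous (Completion.map (star : B → B)) := Completion.continuous_map
    induction x, y using Completion.induction_on₂ with
    | hp => exact isClosed_eq (hc.comp (by fun_prop))
              ((hc.comp continuous_fst).add (hc.comp continuous_snd))
    | ih a b => simp only [← Completion.coe_add, completion_map_star_coe, star_add]

attribute [local instance] completionStarRing

lemma completion_star_coe (b : B) : star (b : Completion B) = ((star b : B) : Completion B) :=
  completion_map_star_coe b

lemma completion_continuous_star : Continuous (star : Completion B → Completion B) :=
  Completion.continuous_map

lemma completion_cStarRing : CStarRing (Completion B) where
  norm_mul_self_le x := by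
    have hc := completion_continuous_star (B := B)
    induction x using Completion.induction_on with
    | hp => exact isClosed_le (continuous_norm.mul continuous_norm)
              (continuous_norm.comp (hc.mul continuous_id))
    | ih a =>
      rw [completion_star_coe, ← Completion.coe_mul, Completion.norm_coe, Completion.norm_coe,
        CStarRing.norm_star_mul_self]

lemma completion_starModule : StarModule ℂ (Completion B) where
  star_smul z x := by
    have hc := completion_continuous_star (B := B)
    induction x using Completion.induction_on with
    | hp => exact isClosed_eq (hc.comp (continuous_const_smul z)) (hc.const_smul (star z))
    | ih a => rw [← Completion.coe_smul, completion_star_coe, completion_star_coe, star_smul,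
        Completion.coe_smul]

/-- The completion of a normed `*`-algebra satisfying the C*-identity is a C*-algebra. -/
@[reducible]
def completionCStarAlgebra : CStarAlgebra (Completion B) :=
  letI : NormedAlgebra ℂ (Completion B) :=
    { (inferInstance : Algebra ℂ (Completion B)) with
      norm_smul_le := fun z x => norm_smul_le z x }
  haveI := completion_cStarRing (B := B)
  haveI := completion_starModule (B := B)
  { }

lemma norm_star_mul_self_le_of_sub_eq (c b d : B) (h : b - star c * c = star d * d) :
    ‖star c * c‖ ≤ ‖b‖ := by
  letI := completionCStarAlgebra (B := B)
  letI := CStarAlgebra.spectralOrder (Completion B)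
  haveI := CStarAlgebra.spectralOrderedRing (Completion B)
  have hs (b : B) : star (b : Completion B) = ((star b : B) : Completion B) :=
    completion_map_star_coe b
  have hm (c : B) : ((star c * c : B) : Completion B) = star (c : Completion B) * (c : Completion B) := by
    rw [hs, Completion.coe_mul]
  have h2 : ((star c * c : B) : Completion B) ≤ (b : Completion B) := by
    rw [← sub_nonneg, ← Completion.coe_sub, h, hm]
    exact star_mul_self_nonneg _
  have := CStarAlgebra.norm_le_norm_of_nonneg_of_le (a := ((star c * c : B) : Completion B))
    (by rw [hm]; exact star_mul_self_nonneg _) h2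
  simpa using this

end Completion

section Algebra

variable {Δ : Type*} {A : Type*} [Ring A] [StarRing A] [Algebra ℂ A] [StarModule ℂ A]

/-- A C*-seminorm on a complex unital `*`-algebra. -/
structure IsCStarSeminorm (p : Seminorm ℂ A) : Prop where
  map_mul_le : ∀ a b, p (a * b) ≤ p a * p b
  map_star : ∀ a, p (star a) = p a
  map_star_mul_self : ∀ a, p (star a * a) = p a ^ 2

/-- The uniform structure of the locally convex topology defined by a family of seminorms. -/
@[reducible]
def seminormUniformSpace {E : Type*} [AddCommGroup E] [Module ℂ E] (p : Δ → Seminorm ℂ E) :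
    UniformSpace E :=
  ⨅ i, (p i).toSeminormedAddCommGroup.toUniformSpace

/-- The unital `*`-algebra `A` is a locally C*-algebra with respect to the family `P`: all `P α`
are C*-seminorms, and the locally convex topology they define is Hausdorff and complete. -/
structure IsLocallyCStarAlgebra (P : Δ → Seminorm ℂ A) : Prop where
  cstar : ∀ α, IsCStarSeminorm (P α)
  separated : ∀ a, (∀ α, P α a = 0) → a = 0
  complete : @CompleteSpace A (seminormUniformSpace P)

variable {p : Seminorm ℂ A}

/-- The kernel of a C*-seminorm, a two-sided `*`-ideal. -/
def IsCStarSeminorm.ker (hp : IsCStarSeminorm p) : Ideal A where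
  carrier := {a | p a = 0}
  add_mem' {a b} ha hb :=
    le_antisymm ((map_add_le_add p a b).trans (by simp_all)) (apply_nonneg p _)
  zero_mem' := map_zero p
  smul_mem' c a ha :=
    le_antisymm ((hp.map_mul_le c a).trans (by simp_all)) (apply_nonneg p _)

lemma IsCStarSeminorm.mem_ker (hp : IsCStarSeminorm p) {a : A} : a ∈ hp.ker ↔ p a = 0 := Iff.rfl

instance (hp : IsCStarSeminorm p) : hp.ker.IsTwoSided where
  mul_mem_of_left {a} b ha :=
    le_antisymm ((hp.map_mul_le a b).trans (by simp [hp.mem_ker.1 ha])) (apply_nonneg p _)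

/-- The quotient `*`-algebra `A / ker p`. -/
def CStarQuotient (hp : IsCStarSeminorm p) : Type _ := A ⧸ hp.ker

namespace CStarQuotient

variable (hp : IsCStarSeminorm p)

instance : Ring (CStarQuotient hp) := inferInstanceAs (Ring (A ⧸ hp.ker))

instance : Algebra ℂ (CStarQuotient hp) := inferInstanceAs (Algebra ℂ (A ⧸ hp.ker))

/-- The quotient map `a ↦ a + ker p`. -/
def mk : A →ₐ[ℂ] CStarQuotient hp := Ideal.Quotient.mkₐ ℂ hp.ker

lemma mk_surjective : Function.Surjective (mk hp) := Ideal.Quotient.mk_surjective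

lemma mk_eq_mk {a b : A} : mk hp a = mk hp b ↔ p (a - b) = 0 :=
  (Ideal.Quotient.mk_eq_mk_iff_sub_mem a b).trans hp.mem_ker

/-- The involution `(a + ker p)* = a* + ker p`. -/
instance : StarRing (CStarQuotient hp) where
  star q := Quotient.liftOn' q (fun a => mk hp (star a)) fun a b h => by
    rw [mk_eq_mk, ← star_sub, hp.map_star]
    exact (mk_eq_mk hp).1 (Quotient.sound' h)
  star_involutive q := by
    obtain ⟨a, rfl⟩ := mk_surjective hp q
    exact congrArg (mk hp) (star_star a)
  star_mul q r := by
    obtain ⟨a, rfl⟩ := mk_surjective hp q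
    obtain ⟨b, rfl⟩ := mk_surjective hp r
    exact congrArg (mk hp) (star_mul a b)
  star_add q r := by
    obtain ⟨a, rfl⟩ := mk_surjective hp q
    obtain ⟨b, rfl⟩ := mk_surjective hp r
    exact congrArg (mk hp) (star_add a b)

lemma star_mk (a : A) : star (mk hp a) = mk hp (star a) := rfl

instance : StarModule ℂ (CStarQuotient hp) where
  star_smul z q := by
    obtain ⟨a, rfl⟩ := mk_surjective hp q
    exact congrArg (mk hp) (star_smul z a)

/-- The norm `‖a + ker p‖ = p a`. -/
instance : Norm (CStarQuotient hp) where
  norm q := Quotient.liftOn' q p fun a b h => by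
    have h' : p (a - b) = 0 := (mk_eq_mk hp).1 (Quotient.sound' h)
    have := abs_sub_map_le_sub p a b
    rw [h'] at this
    exact sub_eq_zero.1 (abs_nonpos_iff.1 this)

lemma norm_mk (a : A) : ‖mk hp a‖ = p a := rfl

lemma normCore : NormedSpace.Core ℂ (CStarQuotient hp) where
  norm_nonneg q := by
    obtain ⟨a, rfl⟩ := mk_surjective hp q
    exact apply_nonneg p a
  norm_smul z q := by
    obtain ⟨a, rfl⟩ := mk_surjective hp q
    exact map_smul_eq_mul p z a
  norm_triangle q r := by
    obtain ⟨a, rfl⟩ := mk_surjective hp q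
    obtain ⟨b, rfl⟩ := mk_surjective hp r
    exact map_add_le_add p a b
  norm_eq_zero_iff q := by
    obtain ⟨a, rfl⟩ := mk_surjective hp q
    rw [← map_zero (mk hp), mk_eq_mk, sub_zero, norm_mk]

instance : NormedRing (CStarQuotient hp) :=
  { NormedAddCommGroup.ofCore (normCore hp), (inferInstance : Ring (CStarQuotient hp)) with
    norm_mul_le := fun q r => by
      obtain ⟨a, rfl⟩ := mk_surjective hp q
      obtain ⟨b, rfl⟩ := mk_surjective hp r
      exact hp.map_mul_le a b }

instance : NormedAlgebra ℂ (CStarQuotient hp) :=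
  { (inferInstance : Algebra ℂ (CStarQuotient hp)) with
    norm_smul_le := fun z q => ((normCore hp).norm_smul z q).le }

instance : CStarRing (CStarQuotient hp) where
  norm_mul_self_le q := by
    obtain ⟨a, rfl⟩ := mk_surjective hp q
    rw [star_mk, ← map_mul, norm_mk, norm_mk, hp.map_star_mul_self, sq]

end CStarQuotient

lemma IsCStarSeminorm.map_star_mul_self_le (hp : IsCStarSeminorm p) (c b d : A)
    (h : b - star c * c = star d * d) : p (star c * c) ≤ p b := by
  have := norm_star_mul_self_le_of_sub_eq (CStarQuotient.mk hp c) (CStarQuotient.mk hp b)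
    (CStarQuotient.mk hp d) (by
      simp only [CStarQuotient.star_mk, ← map_mul, ← map_sub, h])
  simpa only [CStarQuotient.star_mk, ← map_mul, CStarQuotient.norm_mk] using this

end Algebra

section Module

variable {Δ : Type*} {A : Type*} [Ring A] [StarRing A]
  {X : Type*} [AddCommGroup X] [Module Aᵐᵒᵖ X]

/-- An `A`-valued inner product on the right `A`-module `X`, where `x a` is written `op a • x`.
An element of `A` is positive if it is of the form `b* b`. -/
structure IsPreHilbertModule (inn : X → X → A) : Prop where
  inner_self_pos : ∀ x, ∃ b, inn x x = star b * b
  inner_self_eq_zero : ∀ x, inn x x = 0 ↔ x = 0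
  inner_add_left : ∀ x₁ x₂ y, inn (x₁ + x₂) y = inn x₁ y + inn x₂ y
  inner_smul_left : ∀ x y a, inn (op a • x) y = inn x y * a
  star_inner : ∀ x y, star (inn x y) = inn y x

namespace IsPreHilbertModule

variable {inn : X → X → A}

lemma inner_add_right (h : IsPreHilbertModule inn) (x y₁ y₂ : X) : inn x (y₁ + y₂) = inn x y₁ + inn x y₂ := by
  rw [← h.star_inner, h.inner_add_left, star_add, h.star_inner, h.star_inner]

lemma inner_smul_right (h : IsPreHilbertModule inn) (x y : X) (a : A) : inn x (op a • y) = star a * inn x y := by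
  rw [← h.star_inner, h.inner_smul_left, star_mul, h.star_inner]

lemma inner_zero_left (h : IsPreHilbertModule inn) (y : X) : inn 0 y = 0 := by
  simpa using h.inner_add_left 0 0 y

lemma inner_neg_left (h : IsPreHilbertModule inn) (x y : X) : inn (-x) y = -inn x y := by
  have := h.inner_add_left x (-x) y
  rw [add_neg_cancel, h.inner_zero_left] at this
  exact (neg_eq_of_add_eq_zero_right this.symm).symm

lemma inner_sub_left (h : IsPreHilbertModule inn) (x y z : X) : inn (x - y) z = inn x z - inn y z := by
  rw [sub_eq_add_neg, h.inner_add_left, h.inner_neg_left, sub_eq_add_neg]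

lemma inner_sub_right (h : IsPreHilbertModule inn) (x y z : X) : inn x (y - z) = inn x y - inn x z := by
  rw [← h.star_inner, h.inner_sub_left, star_sub, h.star_inner, h.star_inner]

end IsPreHilbertModule

variable [Algebra ℂ A] [StarModule ℂ A] [Module ℂ X] [IsScalarTower ℂ Aᵐᵒᵖ X]
  {p : Seminorm ℂ A} {inn : X → X → A}

lemma IsPreHilbertModule.inner_smul_complex (h : IsPreHilbertModule inn) (z : ℂ) (x y : X) :
    inn (z • x) y = z • inn x y := by
  have : z • x = op (algebraMap ℂ A z) • x := by
    rw [Algebra.algebraMap_eq_smul_one, op_smul, op_one, smul_one_smul]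
  rw [this, h.inner_smul_left, ← Algebra.commutes, Algebra.smul_def]

/-- Cauchy–Bunyakovskii inequality. -/
lemma IsPreHilbertModule.cauchy (h : IsPreHilbertModule inn) (hp : IsCStarSeminorm p) (x y : X) :
    p (inn x y) ^ 2 ≤ p (inn x x) * p (inn y y) := by
  have key (t : ℝ) (ht : 0 ≤ t) :
      2 * t * p (inn x y) ^ 2 ≤ p (inn x x) + t ^ 2 * (p (inn x y) ^ 2 * p (inn y y)) := by
    set w := inn x y with hw
    obtain ⟨d, hd⟩ := h.inner_self_pos (x - op ((t : ℂ) • w) • y)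
    have hyx : inn y x = star w := (h.star_inner x y).symm
    rw [h.inner_sub_left, h.inner_sub_right, h.inner_sub_right, h.inner_smul_left,
      h.inner_smul_right, h.inner_smul_left, h.inner_smul_right, hyx, ← hw] at hd
    have hs : (((√(2 * t) : ℝ) : ℂ) * ((√(2 * t) : ℝ) : ℂ)) = 2 * (t : ℂ) := by
      rw [← Complex.ofReal_mul, Real.mul_self_sqrt (by positivity)]; push_cast; ring
    have hc : star (((√(2 * t) : ℝ) : ℂ) • w) * (((√(2 * t) : ℝ) : ℂ) • w)
        = (2 * (t : ℂ)) • (star w * w) := by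
      rw [star_smul, smul_mul_smul_comm, ← hs]; simp
    have h1 := hp.map_star_mul_self_le (((√(2 * t) : ℝ) : ℂ) • w)
      (inn x x + ((t : ℂ) ^ 2) • (star w * inn y y * w)) d (by
        rw [hc, ← hd]
        simp only [star_smul, mul_smul_comm, smul_mul_assoc, RCLike.star_def, Complex.conj_ofReal,
          smul_smul, mul_assoc, sq, two_mul, add_smul]
        abel)
    rw [hc, map_smul_eq_mul, hp.map_star_mul_self] at h1
    refine le_trans (le_of_eq ?_) (h1.trans ((map_add_le_add p _ _).trans ?_))
    · simp [abs_of_nonneg ht]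
    · rw [map_smul_eq_mul]
      have h2 : ‖((t : ℂ) ^ 2)‖ = t ^ 2 := by simp
      rw [h2]
      have h3 : p (star w * inn y y * w) ≤ p w ^ 2 * p (inn y y) := by
        refine (hp.map_mul_le _ _).trans ?_
        have := hp.map_mul_le (star w) (inn y y)
        rw [hp.map_star] at this
        calc _ ≤ (p w * p (inn y y)) * p w :=
              mul_le_mul_of_nonneg_right this (apply_nonneg p w)
          _ = _ := by ring
      gcongr
  have h0 := apply_nonneg p (inn x x)
  rcases (apply_nonneg p (inn y y)).eq_or_lt with hv | hv
  · rw [← hv] at key ⊢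
    simp only [mul_zero, add_zero] at key ⊢
    by_contra! hlt
    have := key ((p (inn x x) + 1) / p (inn x y) ^ 2) (by positivity)
    rw [mul_assoc, div_mul_cancel₀ _ hlt.ne'] at this
    linarith
  · have := key (p (inn y y))⁻¹ (by positivity)
    field_simp at this
    nlinarith

/-- The seminorm `x ↦ p(⟨x, x⟩)^{1/2}` on a pre-Hilbert module. -/
def innerSeminorm (hp : IsCStarSeminorm p) (h : IsPreHilbertModule inn) : Seminorm ℂ X :=
  Seminorm.of (fun x => √(p (inn x x)))
    (fun x y => by
      refine Real.sqrt_le_iff.2 ⟨by positivity, ?_⟩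
      have hyx : p (inn y x) = p (inn x y) := by rw [← h.star_inner x y, hp.map_star]
      have hxy : p (inn x y) ≤ √(p (inn x x)) * √(p (inn y y)) := by
        rw [← Real.sqrt_mul (apply_nonneg p _)]
        exact Real.le_sqrt_of_sq_le (h.cauchy hp x y)
      have e : inn (x + y) (x + y) = (inn x x + inn x y) + (inn y x + inn y y) := by
        rw [h.inner_add_left, h.inner_add_right, h.inner_add_right]
      have h1 := map_add_le_add p (inn x x + inn x y) (inn y x + inn y y)
      have h2 := map_add_le_add p (inn x x) (inn x y)
      have h3 := map_add_le_add p (inn y x) (inn y y)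
      rw [e]
      nlinarith [Real.sq_sqrt (apply_nonneg p (inn x x)), Real.sq_sqrt (apply_nonneg p (inn y y))])
    (fun z x => by
      have e : inn (z • x) (z • x) = z • (star z • inn x x) := by
        rw [h.inner_smul_complex, ← h.star_inner, h.inner_smul_complex, star_smul, h.star_inner]
      rw [e, map_smul_eq_mul, map_smul_eq_mul, norm_star, ← mul_assoc,
        Real.sqrt_mul (by positivity), Real.sqrt_mul_self (norm_nonneg z)])

lemma innerSeminorm_apply (hp : IsCStarSeminorm p) (h : IsPreHilbertModule inn) (x : X) :
    innerSeminorm hp h x = √(p (inn x x)) := rfl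

lemma innerSeminorm_eq_zero (hp : IsCStarSeminorm p) (h : IsPreHilbertModule inn) (x : X) :
    innerSeminorm hp h x = 0 ↔ inn x x ∈ hp.ker := by
  rw [innerSeminorm_apply, Real.sqrt_eq_zero (apply_nonneg p _), hp.mem_ker]

/-- A Hilbert module over the locally C*-algebra `A`: a pre-Hilbert module which is complete for
the locally convex topology given by the seminorms `x ↦ P α (⟨x, x⟩)^{1/2}`. -/
structure IsHilbertModule {P : Δ → Seminorm ℂ A} (hP : IsLocallyCStarAlgebra P)
    (inn : X → X → A) : Prop extends IsPreHilbertModule inn where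
  complete : @CompleteSpace X
    (seminormUniformSpace fun α => innerSeminorm (hP.cstar α) toIsPreHilbertModule)

/-- A Hilbert module over a C*-algebra `B`, with its norm `‖x‖ = ‖⟨x, x⟩‖^{1/2}`. -/
structure IsHilbertCStarModule {B E : Type*} [NormedRing B] [StarRing B] [NormedAddCommGroup E]
    [Module Bᵐᵒᵖ E] (inn : E → E → B) : Prop extends IsPreHilbertModule inn where
  norm_eq : ∀ x, ‖x‖ = √‖inn x x‖
  complete : CompleteSpace E

/-- The closed submodule `{x | ⟨x, x⟩ ∈ ker p}` of `X`. -/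
def innerKer (hp : IsCStarSeminorm p) (h : IsPreHilbertModule inn) : Submodule Aᵐᵒᵖ X where
  carrier := {x | inn x x ∈ hp.ker}
  zero_mem' := by simp [h.inner_zero_left]
  add_mem' {x y} hx hy := by
    have hx' := (innerSeminorm_eq_zero hp h x).2 hx
    have hy' := (innerSeminorm_eq_zero hp h y).2 hy
    refine (innerSeminorm_eq_zero hp h _).1 (le_antisymm ?_ (apply_nonneg _ _))
    simpa [hx', hy'] using map_add_le_add (innerSeminorm hp h) x y
  smul_mem' a x hx := by
    change inn (op a.unop • x) (op a.unop • x) ∈ hp.ker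
    rw [h.inner_smul_left, h.inner_smul_right]
    exact Ideal.mul_mem_right _ _ (hp.ker.mul_mem_left _ hx)

lemma mem_innerKer (hp : IsCStarSeminorm p) (h : IsPreHilbertModule inn) {x : X} :
    x ∈ innerKer hp h ↔ inn x x ∈ hp.ker := Iff.rfl

lemma inner_mem_ker_left (hp : IsCStarSeminorm p) (h : IsPreHilbertModule inn) {x : X}
    (hx : x ∈ innerKer hp h) (y : X) : p (inn x y) = 0 := by
  have := h.cauchy hp x y
  rw [hp.mem_ker.1 hx, zero_mul] at this
  exact pow_eq_zero_iff two_ne_zero |>.1 (le_antisymm this (sq_nonneg _))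

/-- The quotient `X / {x | ⟨x, x⟩ ∈ ker p}`. -/
def InnerQuotient (hp : IsCStarSeminorm p) (h : IsPreHilbertModule inn) : Type _ :=
  X ⧸ innerKer hp h

namespace InnerQuotient

variable (hp : IsCStarSeminorm p) (h : IsPreHilbertModule inn)

instance : AddCommGroup (InnerQuotient hp h) := inferInstanceAs (AddCommGroup (X ⧸ innerKer hp h))

instance : Module ℂ (InnerQuotient hp h) := inferInstanceAs (Module ℂ (X ⧸ innerKer hp h))

/-- The quotient map. -/
def mk : X →ₗ[ℂ] InnerQuotient hp h := (innerKer hp h).mkQ.restrictScalars ℂ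

lemma mk_surjective : Function.Surjective (mk hp h) := (innerKer hp h).mkQ_surjective

lemma mk_eq_mk {x y : X} : mk hp h x = mk hp h y ↔ x - y ∈ innerKer hp h :=
  Submodule.Quotient.eq (innerKer hp h)

/-- The right action `(x + Ī)(a + I) = x a + Ī`. -/
instance : SMul (CStarQuotient hp)ᵐᵒᵖ (InnerQuotient hp h) where
  smul q x := Quotient.liftOn₂' q.unop x (fun a x => mk hp h (op a • x)) fun a x b y hab hxy => by
    have hab' : a - b ∈ hp.ker := (CStarQuotient.mk_eq_mk hp).1 (Quotient.sound' hab)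
    have hxy' : x - y ∈ innerKer hp h := (mk_eq_mk hp h).1 (Quotient.sound' hxy)
    rw [mk_eq_mk]
    have e : op a • x - op b • y = op a • (x - y) + op (a - b) • y := by
      rw [smul_sub, op_sub, sub_smul]; abel
    rw [e]
    refine add_mem (Submodule.smul_mem _ _ hxy') ?_
    rw [mem_innerKer, h.inner_smul_left]
    exact hp.ker.mul_mem_left _ hab'

lemma smul_mk (a : A) (x : X) : op (CStarQuotient.mk hp a) • mk hp h x = mk hp h (op a • x) := rfl

instance : Module (CStarQuotient hp)ᵐᵒᵖ (InnerQuotient hp h) where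
  one_smul q := by
    obtain ⟨x, rfl⟩ := mk_surjective hp h q
    exact congrArg (mk hp h) (one_smul _ x)
  mul_smul a b q := by
    obtain ⟨x, rfl⟩ := mk_surjective hp h q
    obtain ⟨a, rfl⟩ := op_surjective a
    obtain ⟨b, rfl⟩ := op_surjective b
    obtain ⟨a, rfl⟩ := CStarQuotient.mk_surjective hp a
    obtain ⟨b, rfl⟩ := CStarQuotient.mk_surjective hp b
    exact congrArg (mk hp h) (mul_smul (op a) (op b) x)
  smul_zero a := by
    obtain ⟨a, rfl⟩ := op_surjective a
    obtain ⟨a, rfl⟩ := CStarQuotient.mk_surjective hp a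
    exact congrArg (mk hp h) (smul_zero (op a))
  smul_add a q r := by
    obtain ⟨x, rfl⟩ := mk_surjective hp h q
    obtain ⟨y, rfl⟩ := mk_surjective hp h r
    obtain ⟨a, rfl⟩ := op_surjective a
    obtain ⟨a, rfl⟩ := CStarQuotient.mk_surjective hp a
    exact congrArg (mk hp h) (smul_add (op a) x y)
  add_smul a b q := by
    obtain ⟨x, rfl⟩ := mk_surjective hp h q
    obtain ⟨a, rfl⟩ := op_surjective a
    obtain ⟨b, rfl⟩ := op_surjective b
    obtain ⟨a, rfl⟩ := CStarQuotient.mk_surjective hp a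
    obtain ⟨b, rfl⟩ := CStarQuotient.mk_surjective hp b
    exact congrArg (mk hp h) (add_smul (op a) (op b) x)
  zero_smul q := by
    obtain ⟨x, rfl⟩ := mk_surjective hp h q
    exact congrArg (mk hp h) (zero_smul Aᵐᵒᵖ x)

instance : IsScalarTower ℂ (CStarQuotient hp)ᵐᵒᵖ (InnerQuotient hp h) where
  smul_assoc z a q := by
    obtain ⟨x, rfl⟩ := mk_surjective hp h q
    obtain ⟨a, rfl⟩ := op_surjective a
    obtain ⟨a, rfl⟩ := CStarQuotient.mk_surjective hp a
    exact congrArg (mk hp h) (smul_assoc z (op a) x)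

/-- The inner product `⟨x + Ī, y + Ī⟩ = ⟨x, y⟩ + I`. -/
def inner (q r : InnerQuotient hp h) : CStarQuotient hp :=
  Quotient.liftOn₂' q r (fun x y => CStarQuotient.mk hp (inn x y)) fun x y x' y' hx hy => by
    have hx' : x - x' ∈ innerKer hp h := (mk_eq_mk hp h).1 (Quotient.sound' hx)
    have hy' : y - y' ∈ innerKer hp h := (mk_eq_mk hp h).1 (Quotient.sound' hy)
    rw [CStarQuotient.mk_eq_mk, ← hp.mem_ker]
    have e : inn x y - inn x' y' = inn (x - x') y + star (inn (y - y') x') := by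
      rw [h.star_inner, h.inner_sub_left, h.inner_sub_right]; abel
    rw [e]
    refine add_mem (inner_mem_ker_left hp h hx' y) ?_
    rw [hp.mem_ker, hp.map_star]
    exact inner_mem_ker_left hp h hy' x'

lemma inner_mk (x y : X) :
    inner hp h (mk hp h x) (mk hp h y) = CStarQuotient.mk hp (inn x y) := rfl

/-- The norm `‖x + Ī‖ = p(⟨x, x⟩)^{1/2}`. -/
instance : Norm (InnerQuotient hp h) where
  norm q := Quotient.liftOn' q (innerSeminorm hp h) fun x y hxy => by
    have h' : innerSeminorm hp h (x - y) = 0 :=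
      (innerSeminorm_eq_zero hp h _).2 ((mk_eq_mk hp h).1 (Quotient.sound' hxy))
    have := abs_sub_map_le_sub (innerSeminorm hp h) x y
    rw [h'] at this
    exact sub_eq_zero.1 (abs_nonpos_iff.1 this)

lemma norm_mk (x : X) : ‖mk hp h x‖ = innerSeminorm hp h x := rfl

lemma normCore : NormedSpace.Core ℂ (InnerQuotient hp h) where
  norm_nonneg q := by
    obtain ⟨a, rfl⟩ := mk_surjective hp h q
    exact apply_nonneg (innerSeminorm hp h) a
  norm_smul z q := by
    obtain ⟨a, rfl⟩ := mk_surjective hp h q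
    exact map_smul_eq_mul (innerSeminorm hp h) z a
  norm_triangle q r := by
    obtain ⟨a, rfl⟩ := mk_surjective hp h q
    obtain ⟨b, rfl⟩ := mk_surjective hp h r
    exact map_add_le_add (innerSeminorm hp h) a b
  norm_eq_zero_iff q := by
    obtain ⟨a, rfl⟩ := mk_surjective hp h q
    rw [← map_zero (mk hp h), mk_eq_mk, sub_zero, norm_mk, innerSeminorm_eq_zero, mem_innerKer]

instance : NormedAddCommGroup (InnerQuotient hp h) := NormedAddCommGroup.ofCore (normCore hp h)

instance : NormedSpace ℂ (InnerQuotient hp h) := NormedSpace.ofCore (normCore hp h)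

end InnerQuotient

/-- The set `A^s` of bounded elements: those `a` with `sup_α P α a < ∞`. -/
def boundedElements (P : Δ → Seminorm ℂ A) : Set A := {a | BddAbove (Set.range fun α => P α a)}

variable {P : Δ → Seminorm ℂ A} (hP : IsLocallyCStarAlgebra P) (h : IsPreHilbertModule inn)

lemma inner_mem_boundedElements_iff (x : X) : inn x x ∈ boundedElements P ↔
    BddAbove (Set.range fun α => innerSeminorm (hP.cstar α) h x) := by
  constructor
  · rintro ⟨C, hC⟩
    refine ⟨√C, ?_⟩
    rintro _ ⟨α, rfl⟩
    exact Real.sqrt_le_sqrt (hC ⟨α, rfl⟩)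
  · rintro ⟨C, hC⟩
    refine ⟨C ^ 2, ?_⟩
    rintro _ ⟨α, rfl⟩
    exact (Real.sqrt_le_left ((Real.sqrt_nonneg _).trans (hC ⟨α, rfl⟩))).1 (hC ⟨α, rfl⟩)

/-- The subspace `X^s` of bounded elements: those `x` with `⟨x, x⟩ ∈ A^s`. -/
def boundedPart : Submodule ℂ X where
  carrier := {x | inn x x ∈ boundedElements P}
  zero_mem' := by
    refine ⟨0, ?_⟩
    rintro _ ⟨α, rfl⟩
    simp [h.inner_zero_left]
  add_mem' {x y} hx hy := by
    rw [Set.mem_ofPred_eq, inner_mem_boundedElements_iff hP h] at *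
    obtain ⟨C, hC⟩ := hx
    obtain ⟨D, hD⟩ := hy
    refine ⟨C + D, ?_⟩
    rintro _ ⟨α, rfl⟩
    exact (map_add_le_add (innerSeminorm (hP.cstar α) h) x y).trans
      (add_le_add (hC ⟨α, rfl⟩) (hD ⟨α, rfl⟩))
  smul_mem' z x hx := by
    rw [Set.mem_ofPred_eq, inner_mem_boundedElements_iff hP h] at *
    obtain ⟨C, hC⟩ := hx
    refine ⟨‖z‖ * C, ?_⟩
    rintro _ ⟨α, rfl⟩
    change innerSeminorm (hP.cstar α) h (z • x) ≤ _
    rw [map_smul_eq_mul]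
    exact mul_le_mul_of_nonneg_left (hC ⟨α, rfl⟩) (norm_nonneg z)

namespace boundedPart

lemma bddAbove (x : boundedPart hP h) :
    BddAbove (Set.range fun α => innerSeminorm (hP.cstar α) h (x : X)) :=
  (inner_mem_boundedElements_iff hP h _).1 x.2

/-- The norm `‖x‖^s = sup_α P α (⟨x, x⟩)^{1/2}` on `X^s`. -/
instance : Norm (boundedPart hP h) where
  norm x := ⨆ α, innerSeminorm (hP.cstar α) h (x : X)

lemma norm_def (x : boundedPart hP h) : ‖x‖ = ⨆ α, innerSeminorm (hP.cstar α) h (x : X) := rfl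

lemma le_norm (x : boundedPart hP h) (α : Δ) : innerSeminorm (hP.cstar α) h (x : X) ≤ ‖x‖ :=
  le_ciSup (bddAbove hP h x) α

lemma normCore : NormedSpace.Core ℂ (boundedPart hP h) where
  norm_nonneg x := Real.iSup_nonneg fun α => apply_nonneg _ _
  norm_smul z x := by
    rw [norm_def, norm_def, Real.mul_iSup_of_nonneg (norm_nonneg z)]
    exact iSup_congr fun α => map_smul_eq_mul (innerSeminorm (hP.cstar α) h) z (x : X)
  norm_triangle x y := by
    refine Real.iSup_le (fun α => ?_) (add_nonneg (Real.iSup_nonneg fun α => apply_nonneg _ _)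
      (Real.iSup_nonneg fun α => apply_nonneg _ _))
    exact (map_add_le_add (innerSeminorm (hP.cstar α) h) (x : X) y).trans
      (add_le_add (le_norm hP h x α) (le_norm hP h y α))
  norm_eq_zero_iff x := by
    constructor
    · intro hx
      have h1 : inn (x : X) x = 0 := hP.separated _ fun α => by
        rw [← (hP.cstar α).mem_ker, ← innerSeminorm_eq_zero (hP.cstar α) h]
        exact le_antisymm ((le_norm hP h x α).trans hx.le) (apply_nonneg _ _)
      exact Subtype.ext ((h.inner_self_eq_zero _).1 h1)
    · rintro rfl
      simp [norm_def]

instance : NormedAddCommGroup (boundedPart hP h) := NormedAddCommGroup.ofCore (normCore hP h)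

instance : NormedSpace ℂ (boundedPart hP h) := NormedSpace.ofCore (normCore hP h)

end boundedPart

/-- The subspace `{x ∈ X^s | ⟨x, x⟩ ∈ ker (P α)}` of `X^s`. -/
def boundedKer (α : Δ) : Submodule ℂ (boundedPart hP h) :=
  ((innerKer (hP.cstar α) h).restrictScalars ℂ).comap (boundedPart hP h).subtype

/-- The canonical map `x + J̄_α ↦ x + Ī_α` from `X^s / J̄_α`, which carries the quotient norm
of `‖·‖^s`, to `X / Ī_α`. -/
def boundedQuotientMap (α : Δ) :
    (boundedPart hP h ⧸ boundedKer hP h α) →ₗ[ℂ] InnerQuotient (hP.cstar α) h :=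
  (boundedKer hP h α).liftQ ((InnerQuotient.mk (hP.cstar α) h).comp (boundedPart hP h).subtype)
    fun x hx => by
      rw [LinearMap.mem_ker, ← map_zero (InnerQuotient.mk (hP.cstar α) h)]
      refine (InnerQuotient.mk_eq_mk (hP.cstar α) h).2 ?_
      rw [sub_zero]
      exact hx

end Module

end

open Polynomial Filter Topology

/-! ### Bounds for real polynomials in a positive element -/

section PolynomialCalculus

/-! Everything follows from one truncation. Given `x`, put `c = P α ⟨x, x⟩` and, if `c > 0`, `f t =
√c / √(max t c)`. The vector `y = x f(⟨x, x⟩)` has two properties. Since `f = 1` on `[0, c]`, it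
agrees with `x` modulo the kernel of the seminorm with index `α`; since `√t * f t ≤ √c` for all `t ≥
0`, none of its seminorms exceeds `√c`, the `α`-seminorm of `x`. This is
`IsHilbertModule.exists_bounded_lift`.

To make sense of `x f(⟨x, x⟩)`, approximate `f` by polynomials `q`. The seminorms of `x q(⟨x, x⟩)`
are controlled by `√t * |q t|` on `[0, P β ⟨x, x⟩]`, through the spectrum in the completion of `A /
ker (P β)`, so these vectors converge in `X` (`IsHilbertModule.exists_smul_cfc`).

Lifts of this kind turn an absolutely convergent series in the quotient into one that converges
absolutely for every seminorm upstairs, whence completeness of `X_α`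
(`completeSpace_of_bounded_lifts`); `A_α` is the case `X = A`. They also lie in `X^s`, so `X^s /
J̄_α → X_α` is onto, and they attain the quotient norm, so it is isometric. -/

lemma CStarAlgebra.norm_aeval_star_mul_self_le {B : Type*} [CStarAlgebra B] (b : B) (q : ℝ[X])
    {M : ℝ} (hM : 0 ≤ M) (hq : ∀ t ∈ Set.Icc 0 ‖star b * b‖, |q.eval t| ≤ M) :
    ‖aeval (star b * b) (q.map (algebraMap ℝ ℂ))‖ ≤ M := by
  let := CStarAlgebra.spectralOrder B
  have := CStarAlgebra.spectralOrderedRing B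
  rw [aeval_map_algebraMap, ← cfc_polynomial q (star b * b) (IsSelfAdjoint.star_mul_self b)]
  -- It suffices that the spectrum of the positive element `star b * b` lies in `[0, ‖star b * b‖]`.
  refine norm_cfc_le hM fun t ht => hq t ⟨?_, ?_⟩
  · exact spectrum_nonneg_of_nonneg (star_mul_self_nonneg b) ht
  · rcases subsingleton_or_nontrivial B with _ | _
    · simp [spectrum.of_subsingleton] at ht
    · exact (le_abs_self t).trans (spectrum.norm_le_norm_of_mem ht)

/-- Completeness can be dropped because `B` embeds isometrically in its completion, a C*-algebra.
This matters for `A / ker p`, whose completeness is still to be proved. -/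
lemma norm_aeval_star_mul_self_le {B : Type*} [NormedRing B] [StarRing B] [CStarRing B]
    [NormedAlgebra ℂ B] [StarModule ℂ B] (b : B) (q : ℝ[X]) {M : ℝ} (hM : 0 ≤ M)
    (hq : ∀ t ∈ Set.Icc 0 ‖star b * b‖, |q.eval t| ≤ M) :
    ‖aeval (star b * b) (q.map (algebraMap ℝ ℂ))‖ ≤ M := by
  let := completionCStarAlgebra (B := B)
  have hm : ((star b * b : B) : UniformSpace.Completion B)
      = star (b : UniformSpace.Completion B) * (b : UniformSpace.Completion B) := by
    rw [UniformSpace.Completion.coe_mul]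
    exact congrArg (· * _) (completion_map_star_coe b).symm
  have he : ((aeval (star b * b) (q.map (algebraMap ℝ ℂ)) : B) : UniformSpace.Completion B)
      = aeval (star (b : UniformSpace.Completion B) * (b : UniformSpace.Completion B))
        (q.map (algebraMap ℝ ℂ)) := by
    rw [← hm]
    exact hom_eval₂ _ _ UniformSpace.Completion.coeRingHom _
  rw [← UniformSpace.Completion.norm_coe, he]
  refine CStarAlgebra.norm_aeval_star_mul_self_le _ q hM ?_
  rw [← hm, UniformSpace.Completion.norm_coe]
  exact hq

variable {A : Type*} [Ring A] [StarRing A] [Algebra ℂ A] [StarModule ℂ A]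

lemma IsCStarSeminorm.aeval_star_mul_self_le {p : Seminorm ℂ A} (hp : IsCStarSeminorm p) (b : A)
    (q : ℝ[X]) {M : ℝ} (hM : 0 ≤ M) (hq : ∀ t ∈ Set.Icc 0 (p (star b * b)), |q.eval t| ≤ M) :
    p (aeval (star b * b) (q.map (algebraMap ℝ ℂ))) ≤ M := by
  have := norm_aeval_star_mul_self_le (CStarQuotient.mk hp b) q hM (by
    rwa [CStarQuotient.star_mk, ← map_mul, CStarQuotient.norm_mk])
  rwa [CStarQuotient.star_mk, ← map_mul, aeval_algHom_apply, CStarQuotient.norm_mk] at this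

lemma IsSelfAdjoint.aeval_map_ofReal {a : A} (ha : IsSelfAdjoint a) (q : ℝ[X]) :
    IsSelfAdjoint (aeval a (q.map (algebraMap ℝ ℂ))) := by
  induction q using Polynomial.induction_on' with
  | add f g hf hg => simpa using hf.add hg
  | monomial n r =>
    rw [map_monomial, aeval_monomial, ← Algebra.smul_def]
    exact IsSelfAdjoint.smul (by simp [IsSelfAdjoint]) (ha.pow n)

variable {X : Type*} [AddCommGroup X] [Module Aᵐᵒᵖ X] [Module ℂ X] [IsScalarTower ℂ Aᵐᵒᵖ X]
  {p : Seminorm ℂ A} {inn : X → X → A}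

/-- With `a = ⟨x, x⟩`, the self-adjointness of `q(a)` gives `⟨x q(a), x q(a)⟩ = q(a) a q(a)`. This
is the polynomial `q X q` at `a`, with values `(√t * |q t|) ^ 2`; hence the weight `√t`. -/
lemma innerSeminorm_aeval_smul_le (hp : IsCStarSeminorm p) (h : IsPreHilbertModule inn) (x : X)
    (q : ℝ[X]) {M : ℝ} (hM : 0 ≤ M)
    (hq : ∀ t ∈ Set.Icc 0 (p (inn x x)), √t * |q.eval t| ≤ M) :
    innerSeminorm hp h (op (aeval (inn x x) (q.map (algebraMap ℝ ℂ))) • x) ≤ M := by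
  rw [innerSeminorm_apply]
  refine Real.sqrt_le_iff.2 ⟨hM, ?_⟩
  obtain ⟨b, hb⟩ := h.inner_self_pos x
  have hsa : IsSelfAdjoint (inn x x) := h.star_inner x x
  have e : inn (op (aeval (inn x x) (q.map (algebraMap ℝ ℂ))) • x)
      (op (aeval (inn x x) (q.map (algebraMap ℝ ℂ))) • x)
      = aeval (star b * b) ((q * Polynomial.X * q).map (algebraMap ℝ ℂ)) := by
    rw [h.inner_smul_left, h.inner_smul_right, (hsa.aeval_map_ofReal q).star_eq, ← hb]
    simp
  rw [e]
  refine hp.aeval_star_mul_self_le b _ (sq_nonneg M) fun t ht => ?_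
  rw [← hb] at ht
  have h1 := pow_le_pow_left₀ (by positivity) (hq t ht) 2
  rw [mul_pow, Real.sq_sqrt ht.1, sq_abs] at h1
  rw [eval_mul, eval_mul, eval_X, abs_of_nonneg (by nlinarith [ht.1, sq_nonneg (q.eval t)])]
  linarith

end PolynomialCalculus

/-! ### Completeness of a quotient from bounded lifts -/

section Completeness

variable {Δ E : Type*} [AddCommGroup E] [Module ℂ E]

/-- In an infimum of uniform structures, being Cauchy and converging can both be tested one seminorm
at a time. -/
lemma exists_tendsto_of_seminorm_cauchy {p : Δ → Seminorm ℂ E}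
    (hc : @CompleteSpace E (seminormUniformSpace p)) (u : ℕ → E)
    (hu : ∀ β, ∀ ε > 0, ∃ N, ∀ m ≥ N, ∀ n ≥ N, p β (u m - u n) < ε) :
    ∃ y, ∀ β, Tendsto (fun n => p β (u n - y)) atTop (𝓝 0) := by
  let := seminormUniformSpace p
  have hcs : CauchySeq u := by
    unfold CauchySeq
    rw [cauchy_iInf_uniformSpace']
    intro β
    let := (p β).toSeminormedAddCommGroup
    refine Metric.cauchySeq_iff.2 fun ε hε => ?_
    simp only [dist_eq_norm]
    exact hu β ε hε
  obtain ⟨y, hy⟩ := cauchySeq_tendsto_of_complete hcs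
  refine ⟨y, fun β => ?_⟩
  rw [UniformSpace.toTopologicalSpace_iInf, nhds_iInf, tendsto_iInf] at hy
  let := (p β).toSeminormedAddCommGroup
  exact tendsto_iff_norm_sub_tendsto_zero.1 (hy β)

/-- A normed space is complete if it is the quotient of a complete locally convex space by one of
the defining seminorms, provided that every vector has a lift which is no larger for any of the
other seminorms. -/
lemma completeSpace_of_bounded_lifts {p : Δ → Seminorm ℂ E}
    (hc : @CompleteSpace E (seminormUniformSpace p)) {F : Type*} [NormedAddCommGroup F]
    (f : E →+ F) (hf : Function.Surjective f) (α : Δ) (hfα : ∀ x, ‖f x‖ = p α x)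
    (hl : ∀ x, ∃ y, p α (x - y) = 0 ∧ ∀ β, p β y ≤ p α x) : CompleteSpace F := by
  refine NormedAddCommGroup.completeSpace_of_summable_imp_tendsto fun u hu => ?_
  have hl' (ξ : F) : ∃ y, f y = ξ ∧ ∀ β, p β y ≤ ‖ξ‖ := by
    obtain ⟨x, rfl⟩ := hf ξ
    obtain ⟨y, hy, hyβ⟩ := hl x
    refine ⟨y, ?_, by simpa only [hfα] using hyβ⟩
    rw [← hfα, map_sub, norm_eq_zero, sub_eq_zero] at hy
    exact hy.symm
  choose g hfg hg using hl'
  -- The lifts satisfy `p β (g (u i)) ≤ ‖u i‖` for every `β`, so their partial sums are Cauchy for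
  -- all seminorms at once.
  obtain ⟨y, hy⟩ := exists_tendsto_of_seminorm_cauchy hc
    (fun n => ∑ i ∈ Finset.range n, g (u i)) fun β => by
      let := (p β).toSeminormedAddCommGroup
      have := cauchySeq_range_of_norm_bounded hu.hasSum.tendsto_sum_nat.cauchySeq
        (f := fun i => g (u i)) fun i => hg (u i) β
      simp only [Metric.cauchySeq_iff, dist_eq_norm] at this
      exact this
  refine ⟨f y, tendsto_iff_norm_sub_tendsto_zero.2 ?_⟩
  refine (hy α).congr fun n => ?_
  rw [← hfα, map_sub, map_sum]
  simp only [hfg]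

end Completeness

/-! ### Functional calculus on a vector and the truncation -/

section Truncation

/-- The intervals grow because `P β ⟨x, x⟩` may be unbounded in `β`; a single sequence must
eventually work for each `β`. -/
lemma exists_polynomial_seq_near {f : ℝ → ℝ} (hf : Continuous f) :
    ∃ q : ℕ → ℝ[X], ∀ n : ℕ, ∀ t ∈ Set.Icc (0 : ℝ) n, |(q n).eval t - f t| ≤ 1 / ((n : ℝ) + 1) := by
  choose q hq using fun n : ℕ => exists_polynomial_near_of_continuousOn 0 n f hf.continuousOn
    (1 / ((n : ℝ) + 1)) Nat.one_div_pos_of_nat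
  exact ⟨q, fun n t ht => (hq n t ht).le⟩

variable {Δ A X : Type*} [Ring A] [StarRing A] [Algebra ℂ A] [StarModule ℂ A]
  [AddCommGroup X] [Module Aᵐᵒᵖ X] [Module ℂ X] [IsScalarTower ℂ Aᵐᵒᵖ X]
  {P : Δ → Seminorm ℂ A} {hP : IsLocallyCStarAlgebra P} {inn : X → X → A}

/-- Continuous functional calculus applied to a vector: the vector `x f(⟨x, x⟩)`, given as the
limit of `x q(⟨x, x⟩)` for polynomials `q`. -/
lemma IsHilbertModule.exists_smul_cfc (hX : IsHilbertModule hP inn) (x : X) {f : ℝ → ℝ}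
    (hf : Continuous f) : ∃ y, ∀ β (r M : ℝ), 0 ≤ M →
      (∀ t ∈ Set.Icc 0 (P β (inn x x)), √t * |r - f t| ≤ M) →
      innerSeminorm (hP.cstar β) hX.toIsPreHilbertModule ((r : ℂ) • x - y) ≤ M := by
  obtain ⟨q, hq⟩ := exists_polynomial_seq_near hf
  set s : Δ → Seminorm ℂ X := fun β => innerSeminorm (hP.cstar β) hX.toIsPreHilbertModule with hs
  set ev : ℝ[X] → X := fun q => op (aeval (inn x x) (q.map (algebraMap ℝ ℂ))) • x with hev
  have hev_sub (q₁ q₂ : ℝ[X]) : ev (q₁ - q₂) = ev q₁ - ev q₂ := by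
    simp [hev, sub_smul]
  -- Treating `r • x` as a constant polynomial applied to `x` lets `hle` also bound `r • x - ev q`.
  have hev_C (r : ℝ) : ev (C r) = (r : ℂ) • x := by
    simp [hev, Algebra.algebraMap_eq_smul_one]
  have hle (β : Δ) (q : ℝ[X]) {M : ℝ} (hM : 0 ≤ M)
      (h : ∀ t ∈ Set.Icc 0 (P β (inn x x)), √t * |q.eval t| ≤ M) : s β (ev q) ≤ M :=
    innerSeminorm_aeval_smul_le (hP.cstar β) hX.toIsPreHilbertModule x q hM h
  have hsqrt {β : Δ} {t : ℝ} (ht : t ∈ Set.Icc 0 (P β (inn x x))) : √t ≤ √(P β (inn x x)) :=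
    Real.sqrt_le_sqrt ht.2
  have hlim (β : Δ) : Tendsto (fun n : ℕ => √(P β (inn x x)) * (1 / ((n : ℝ) + 1))) atTop (𝓝 0) := by
    simpa using tendsto_one_div_add_atTop_nhds_zero_nat.const_mul √(P β (inn x x))
  obtain ⟨y, hy⟩ := exists_tendsto_of_seminorm_cauchy hX.complete (fun n => ev (q n)) (by
    intro β ε hε
    -- `N` makes the approximation interval contain `[0, P β ⟨x, x⟩]`; `N'` makes the weighted error
    -- less than `ε / 3`. Two such errors stay strictly below `ε`, although `hle` is not strict.
    obtain ⟨N, hN⟩ := exists_nat_ge (P β (inn x x))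
    obtain ⟨N', hN'⟩ := eventually_atTop.1 ((hlim β).eventually (gt_mem_nhds (by linarith : 0 < ε / 3)))
    refine ⟨max N N', fun m hm n hn => ?_⟩
    rw [ge_iff_le, max_le_iff] at hm hn
    have hb (k : ℕ) (hk : N ≤ k) (hk' : N' ≤ k) (t : ℝ) (ht : t ∈ Set.Icc 0 (P β (inn x x))) :
        √t * |(q k).eval t - f t| ≤ ε / 3 :=
      (mul_le_mul (hsqrt ht) (hq k t ⟨ht.1, (ht.2.trans hN).trans (by exact_mod_cast hk)⟩)
        (abs_nonneg _) (Real.sqrt_nonneg _)).trans (hN' k hk').le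
    rw [← hev_sub]
    refine lt_of_le_of_lt (hle β _ (M := ε / 3 + ε / 3) (by positivity) fun t ht => ?_)
      (by linarith)
    refine le_trans ?_ (add_le_add (hb m hm.1 hm.2 t ht) (hb n hn.1 hn.2 t ht))
    rw [← mul_add, eval_sub]
    refine mul_le_mul_of_nonneg_left ?_ (Real.sqrt_nonneg t)
    rw [abs_sub_comm ((q n).eval t)]
    exact abs_sub_le _ _ _)
  refine ⟨y, fun β r M hM h => ?_⟩
  obtain ⟨N, hN⟩ := exists_nat_ge (P β (inn x x))
  -- Compare `r • x` with `y` through `ev (q (n + N))`; the shift by `N` makes the bound valid for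
  -- every `n`.
  refine ge_of_tendsto' (x := atTop)
    (f := fun n : ℕ => M + √(P β (inn x x)) * (1 / (((n + N : ℕ) : ℝ) + 1)) + s β (ev (q (n + N)) - y))
    ?_ fun n => ?_
  · simpa using (((tendsto_add_atTop_iff_nat N).2 (hlim β)).const_add M).add
      ((tendsto_add_atTop_iff_nat N).2 (hy β))
  · refine (le_trans (le_of_eq ?_) (map_add_le_add (s β) ((r : ℂ) • x - ev (q (n + N)))
      (ev (q (n + N)) - y))).trans (add_le_add_left ?_ _)
    · rw [sub_add_sub_cancel]
    · rw [← hev_C, ← hev_sub]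
      refine hle β _ (by positivity) fun t ht => ?_
      have h1 := h t ht
      have h2 := mul_le_mul (hsqrt ht) (hq (n + N) t ⟨ht.1, (ht.2.trans hN).trans (by simp)⟩)
        (abs_nonneg _) (Real.sqrt_nonneg _)
      refine le_trans ?_ (add_le_add h1 h2)
      rw [← mul_add, eval_sub, eval_C, abs_sub_comm ((q (n + N)).eval t)]
      exact mul_le_mul_of_nonneg_left (abs_sub_le _ _ _) (Real.sqrt_nonneg t)

/-- Modulo the kernel of the seminorm with index `α`, every vector `x` agrees with a bounded vector
whose seminorms are all at most the seminorm of `x` with index `α`. -/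
lemma IsHilbertModule.exists_bounded_lift (hX : IsHilbertModule hP inn) (α : Δ) (x : X) :
    ∃ y, innerSeminorm (hP.cstar α) hX.toIsPreHilbertModule (x - y) = 0 ∧
      ∀ β, innerSeminorm (hP.cstar β) hX.toIsPreHilbertModule y ≤
        innerSeminorm (hP.cstar α) hX.toIsPreHilbertModule x := by
  set c := P α (inn x x) with hc
  rcases (apply_nonneg (P α) (inn x x)).eq_or_lt with h0 | h0
  -- For `c = 0` the quotient defining `f` degenerates at `t = 0`, but `x` is then in the kernel and
  -- `0` is a lift.
  · refine ⟨0, ?_, fun β => by simp⟩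
    rw [sub_zero, innerSeminorm_apply, ← h0, Real.sqrt_zero]
  · rw [← hc] at h0
    have hpos (t : ℝ) : 0 < √(max t c) := Real.sqrt_pos.2 (lt_max_of_lt_right h0)
    obtain ⟨y, hy⟩ := hX.exists_smul_cfc x (f := fun t => √c / √(max t c)) <|
      continuous_const.div (by fun_prop) fun t => (hpos t).ne'
    refine ⟨y, le_antisymm ?_ (apply_nonneg _ _), fun β => ?_⟩
    -- `r = 1`, `M = 0`: on `[0, c]` the function is exactly `1`.
    · simpa using hy α 1 0 le_rfl fun t ht => by
        rw [max_eq_right ht.2, div_self (Real.sqrt_pos.2 h0).ne']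
        simp
    -- `r = 0`, `M = √c`: this bounds `y` itself, by `√t ≤ √(max t c)`.
    · have := hy β 0 √c (Real.sqrt_nonneg c) fun t ht => by
        rw [zero_sub, abs_neg, abs_of_nonneg (by positivity), mul_div_assoc', div_le_iff₀ (hpos t),
          mul_comm]
        exact mul_le_mul_of_nonneg_left (Real.sqrt_le_sqrt (le_max_left t c)) (Real.sqrt_nonneg c)
      simpa [innerSeminorm_apply, hc] using this

end Truncation

/-! ### The quotients of `A`, `X` and `X^s` -/

section Quotients

variable {Δ A X : Type*} [Ring A] [StarRing A] [Algebra ℂ A] [StarModule ℂ A]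
  [AddCommGroup X] [Module Aᵐᵒᵖ X] [Module ℂ X] [IsScalarTower ℂ Aᵐᵒᵖ X]
  {P : Δ → Seminorm ℂ A} {p : Seminorm ℂ A} {inn : X → X → A}

/-- Viewing `A` as a module over itself makes the truncation of vectors apply to elements of `A`; by
the C*-identity the module seminorms are the `P α` themselves. -/
lemma IsLocallyCStarAlgebra.isPreHilbertModule_self (hP : IsLocallyCStarAlgebra P) :
    IsPreHilbertModule (fun a b : A => star b * a) where
  inner_self_pos a := ⟨a, rfl⟩
  inner_self_eq_zero a := by
    refine ⟨fun h => hP.separated a fun α => ?_, fun h => by simp [h]⟩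
    rw [← pow_eq_zero_iff two_ne_zero, ← (hP.cstar α).map_star_mul_self, h, map_zero]
  inner_add_left := by simp [mul_add]
  inner_smul_left := by simp [mul_assoc]
  star_inner := by simp

lemma IsLocallyCStarAlgebra.innerSeminorm_self (hP : IsLocallyCStarAlgebra P) (α : Δ) :
    innerSeminorm (hP.cstar α) hP.isPreHilbertModule_self = P α := by
  ext a
  rw [innerSeminorm_apply, (hP.cstar α).map_star_mul_self, Real.sqrt_sq (apply_nonneg _ _)]

lemma IsLocallyCStarAlgebra.isHilbertModule_self (hP : IsLocallyCStarAlgebra P) :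
    IsHilbertModule hP (fun a b : A => star b * a) where
  toIsPreHilbertModule := hP.isPreHilbertModule_self
  complete := by
    have e : (fun α => innerSeminorm (hP.cstar α) hP.isPreHilbertModule_self) = P :=
      funext hP.innerSeminorm_self
    rw [e]
    exact hP.complete

lemma IsLocallyCStarAlgebra.completeSpace_quotient (hP : IsLocallyCStarAlgebra P) (α : Δ) :
    CompleteSpace (CStarQuotient (hP.cstar α)) := by
  refine completeSpace_of_bounded_lifts hP.complete
    (CStarQuotient.mk (hP.cstar α) : A →+ CStarQuotient (hP.cstar α))
    (CStarQuotient.mk_surjective _) α (CStarQuotient.norm_mk _) fun a => ?_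
  simpa only [hP.innerSeminorm_self] using hP.isHilbertModule_self.exists_bounded_lift α a

lemma InnerQuotient.isPreHilbertModule (hp : IsCStarSeminorm p) (h : IsPreHilbertModule inn) :
    IsPreHilbertModule (InnerQuotient.inner hp h) where
  inner_self_pos q := by
    obtain ⟨x, rfl⟩ := mk_surjective hp h q
    obtain ⟨b, hb⟩ := h.inner_self_pos x
    exact ⟨CStarQuotient.mk hp b, by
      rw [inner_mk, hb, map_mul, CStarQuotient.star_mk]⟩
  inner_self_eq_zero q := by
    obtain ⟨x, rfl⟩ := mk_surjective hp h q
    rw [inner_mk, ← map_zero (CStarQuotient.mk hp), CStarQuotient.mk_eq_mk, sub_zero,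
      ← map_zero (mk hp h), mk_eq_mk, sub_zero, mem_innerKer, hp.mem_ker]
  inner_add_left q r s := by
    obtain ⟨x, rfl⟩ := mk_surjective hp h q
    obtain ⟨y, rfl⟩ := mk_surjective hp h r
    obtain ⟨z, rfl⟩ := mk_surjective hp h s
    rw [← map_add, inner_mk, inner_mk, inner_mk, h.inner_add_left, map_add]
  inner_smul_left q r a := by
    obtain ⟨x, rfl⟩ := mk_surjective hp h q
    obtain ⟨y, rfl⟩ := mk_surjective hp h r
    obtain ⟨a, rfl⟩ := CStarQuotient.mk_surjective hp a
    rw [smul_mk, inner_mk, inner_mk, h.inner_smul_left, map_mul]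
  star_inner q r := by
    obtain ⟨x, rfl⟩ := mk_surjective hp h q
    obtain ⟨y, rfl⟩ := mk_surjective hp h r
    rw [inner_mk, inner_mk, CStarQuotient.star_mk, h.star_inner]

variable {hP : IsLocallyCStarAlgebra P}

lemma IsHilbertModule.isHilbertCStarModule_quotient (hX : IsHilbertModule hP inn) (α : Δ) :
    IsHilbertCStarModule (InnerQuotient.inner (hP.cstar α) hX.toIsPreHilbertModule) where
  toIsPreHilbertModule := InnerQuotient.isPreHilbertModule _ _
  norm_eq q := by
    obtain ⟨x, rfl⟩ := InnerQuotient.mk_surjective _ _ q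
    rfl
  complete := completeSpace_of_bounded_lifts hX.complete
    (InnerQuotient.mk (hP.cstar α) hX.toIsPreHilbertModule).toAddMonoidHom
    (InnerQuotient.mk_surjective _ _) α (InnerQuotient.norm_mk _ _) (hX.exists_bounded_lift α)

lemma boundedQuotientMap_mk (h : IsPreHilbertModule inn) (α : Δ) (x : boundedPart hP h) :
    boundedQuotientMap hP h α (Submodule.Quotient.mk x) = InnerQuotient.mk (hP.cstar α) h (x : X) :=
  rfl

lemma IsHilbertModule.exists_boundedPart_lift (hX : IsHilbertModule hP inn) (α : Δ) (x : X) :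
    ∃ y : boundedPart hP hX.toIsPreHilbertModule,
      InnerQuotient.mk (hP.cstar α) hX.toIsPreHilbertModule (y : X) = InnerQuotient.mk _ _ x ∧
      ‖y‖ ≤ innerSeminorm (hP.cstar α) hX.toIsPreHilbertModule x := by
  obtain ⟨y, hy, hyβ⟩ := hX.exists_bounded_lift α x
  have hb : y ∈ boundedPart hP hX.toIsPreHilbertModule :=
    (inner_mem_boundedElements_iff hP hX.toIsPreHilbertModule y).2
      ⟨_, by rintro _ ⟨β, rfl⟩; exact hyβ β⟩
  refine ⟨⟨y, hb⟩, ?_, Real.iSup_le hyβ (apply_nonneg _ _)⟩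
  exact ((InnerQuotient.mk_eq_mk _ _).2 ((innerSeminorm_eq_zero _ _ _).1 hy)).symm

lemma IsHilbertModule.boundedQuotientMap_surjective (hX : IsHilbertModule hP inn) (α : Δ) :
    Function.Surjective (boundedQuotientMap hP hX.toIsPreHilbertModule α) := fun q => by
  obtain ⟨x, rfl⟩ := InnerQuotient.mk_surjective _ _ q
  obtain ⟨y, hy, -⟩ := hX.exists_boundedPart_lift α x
  exact ⟨Submodule.Quotient.mk y, hy⟩

lemma IsHilbertModule.boundedQuotientMap_norm (hX : IsHilbertModule hP inn) (α : Δ)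
    (q : boundedPart hP hX.toIsPreHilbertModule ⧸ boundedKer hP hX.toIsPreHilbertModule α) :
    ‖boundedQuotientMap hP hX.toIsPreHilbertModule α q‖ = ‖q‖ := by
  obtain ⟨x, rfl⟩ := Submodule.Quotient.mk_surjective _ q
  refine le_antisymm ?_ ?_
  -- The image depends only on the class, so a nearly optimal representative `z` may be used; its
  -- `α`-seminorm is at most its supremum norm.
  · refine le_of_forall_pos_lt_add fun ε hε => ?_
    obtain ⟨z, hz, hzε⟩ := Submodule.Quotient.norm_mk_lt
      (Submodule.Quotient.mk (p := boundedKer hP hX.toIsPreHilbertModule α) x) hε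
    rw [← hz, boundedQuotientMap_mk, InnerQuotient.norm_mk, hz]
    exact (boundedPart.le_norm hP hX.toIsPreHilbertModule z α).trans_lt hzε
  -- The truncated lift is a representative of the same class whose supremum norm is already at most
  -- the norm of the image.
  · obtain ⟨y, hy, hn⟩ := hX.exists_boundedPart_lift α (x : X)
    have hxy : (Submodule.Quotient.mk x : _ ⧸ boundedKer hP hX.toIsPreHilbertModule α)
        = Submodule.Quotient.mk y :=
      ((Submodule.Quotient.eq (boundedKer hP hX.toIsPreHilbertModule α)).2
        ((InnerQuotient.mk_eq_mk _ _).1 hy)).symm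
    rw [boundedQuotientMap_mk, InnerQuotient.norm_mk, hxy]
    exact (Submodule.Quotient.norm_mk_le _ y).trans hn

end Quotients

theorem theorem2p2 {Δ A X : Type*} [Ring A] [StarRing A] [Algebra ℂ A] [StarModule ℂ A]
    [AddCommGroup X] [Module Aᵐᵒᵖ X] [Module ℂ X] [IsScalarTower ℂ Aᵐᵒᵖ X]
    (P : Δ → Seminorm ℂ A) (hP : IsLocallyCStarAlgebra P)
    (inn : X → X → A) (hX : IsHilbertModule hP inn) (α : Δ) :
    CompleteSpace (CStarQuotient (hP.cstar α)) ∧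
    IsHilbertCStarModule (InnerQuotient.inner (hP.cstar α) hX.toIsPreHilbertModule) ∧
    Isometry (boundedQuotientMap hP hX.toIsPreHilbertModule α) ∧
    IsClosed (Set.range (boundedQuotientMap hP hX.toIsPreHilbertModule α)) ∧
    DenseRange (boundedQuotientMap hP hX.toIsPreHilbertModule α) := by
  -- The image is all of `X_α`, hence both closed and dense.
  have hs := hX.boundedQuotientMap_surjective α
  refine ⟨hP.completeSpace_quotient α, hX.isHilbertCStarModule_quotient α,
    AddMonoidHomClass.isometry_of_norm _ (hX.boundedQuotientMap_norm α), ?_, hs.denseRange⟩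
  rw [hs.range_eq]
  exact isClosed_univ
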